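/- All graphs are finite, simple, undirected and have at least one vertex; a graph is planar if it can be embedded in the plane. For a vertex $v$ of $G$, $G-v$ is the graph obtained by deleting $v$ and its edges. A graph $G$ is \emph{not apex} if $G-v$ is nonplanar for every vertex $v$ of $G$. A graph $H$ is a \emph{minor} of $G$ if it can be obtained by contracting edges in a subgraph of $G$ (loops and repeated edges being removed), and a \emph{proper} minor if moreover it is not isomorphic to $G$. A graph is \emph{MMNA} (minor minimal not apex) if it is not apex but none of its proper minors is not apex. The \emph{connectivity} $\kappa(G)$ is the largest integer $k$ such that $|V(G)|>k$ and no set of fewer than $k$ vertices of $G$ has a deletion that leaves a disconnected graph. \textbf{Theorem.} If $G$ is MMNA, then $\kappa(G)\le 5$. This bound is sharp: the complete graph $K_6$ is MMNA and $\kappa(K_6)=5$. -/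

import Mathlib

universe u v

namespace SimpleGraph

/-- `A` is an arc of the Euclidean plane with end points `x` and `y`: the image of an injective
continuous path from `x` to `y`. -/
def IsPlaneArc (A : Set (EuclideanSpace ℝ (Fin 2))) (x y : EuclideanSpace ℝ (Fin 2)) : Prop :=
  ∃ γ : _root_.Path x y, Function.Injective γ ∧ Set.range γ = A

/-- An embedding of the graph `G` in the Euclidean plane: the vertices are distinct points, each
edge is an arc joining its two ends and passing through no other vertex, and two different edges
meet only in ends that they have in common. (Values of `edge` off the edge set play no role.) -/
structure PlaneEmbedding {V : Type u} (G : SimpleGraph V) where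
  point : V → EuclideanSpace ℝ (Fin 2)
  edge : Sym2 V → Set (EuclideanSpace ℝ (Fin 2))
  point_injective : Function.Injective point
  isPlaneArc : ∀ a b, G.Adj a b → IsPlaneArc (edge s(a, b)) (point a) (point b)
  mem_of_point_mem : ∀ e ∈ G.edgeSet, ∀ c, point c ∈ edge e → c ∈ e
  edge_inter_edge : ∀ e ∈ G.edgeSet, ∀ f ∈ G.edgeSet, e ≠ f →
    edge e ∩ edge f ⊆ point '' {c | c ∈ e ∧ c ∈ f}

/-- A graph is planar if it can be embedded in the plane. -/
def IsPlanar {V : Type u} (G : SimpleGraph V) : Prop :=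
  Nonempty (PlaneEmbedding G)

/-- `G - x`: delete the vertex `x` and all edges at `x`. -/
abbrev deleteVertex {V : Type u} (G : SimpleGraph V) (x : V) : SimpleGraph ({x}ᶜ : Set V) :=
  G.induce ({x}ᶜ : Set V)

/-- `G` is not apex: the deletion of any vertex leaves a nonplanar graph. Graphs have at least one
vertex by convention; without this the graph on no vertices would qualify vacuously. -/
def IsNotApex {V : Type u} (G : SimpleGraph V) : Prop :=
  Nonempty V ∧ ∀ x : V, ¬ (G.deleteVertex x).IsPlanar

/-- `H` arises from `K` by contracting edges, with parallel edges merged and loops dropped: the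
map `φ` sends each vertex of `K` to the vertex of `H` into which it is contracted; what is
contracted into one vertex is a connected subgraph. -/
def IsContraction {W : Type v} {V : Type u} (H : SimpleGraph W) (K : SimpleGraph V) : Prop :=
  ∃ φ : V → W, (∀ a : W, (K.induce (φ ⁻¹' {a})).Connected) ∧
    ∀ a b : W, H.Adj a b ↔ a ≠ b ∧ ∃ x y : V, K.Adj x y ∧ φ x = a ∧ φ y = b

/-- `H` is a minor of `G`: it is obtained by contracting edges in a subgraph of `G`. -/
def IsMinor {W : Type v} {V : Type u} (H : SimpleGraph W) (G : SimpleGraph V) : Prop :=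
  ∃ K : G.Subgraph, IsContraction H K.coe

/-- A proper minor of `G` is a minor that is not (isomorphic to) `G` itself. -/
def IsProperMinor {W : Type v} {V : Type u} (H : SimpleGraph W) (G : SimpleGraph V) : Prop :=
  H.IsMinor G ∧ IsEmpty (H ≃g G)

/-- `G` is minor minimal `P`: it has the property `P`, but no proper minor of it has. -/
def IsMinorMinimal (P : ∀ {W : Type u}, SimpleGraph W → Prop) {V : Type u}
    (G : SimpleGraph V) : Prop :=
  P G ∧ ∀ (W : Type u) (H : SimpleGraph W), H.IsProperMinor G → ¬ P H

/-- `G` is minor minimal not apex (MMNA). -/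
def IsMMNA {V : Type u} (G : SimpleGraph V) : Prop :=
  IsMinorMinimal IsNotApex G

/-- `U` is a cut set of `G`: the deletion of `U` leaves a disconnected graph, that is, one with
two vertices that no walk joins. -/
def IsCutSet {V : Type u} (G : SimpleGraph V) (U : Set V) : Prop :=
  ¬ (G.induce Uᶜ).Preconnected

/-- The connectivity `κ(G)` of a finite graph: the largest `k` such that `G` has more than `k`
vertices and no cut set of fewer than `k` vertices. -/
noncomputable def vertexConnectivity {V : Type u} (G : SimpleGraph V) : ℕ :=
  sSup {k : ℕ | k < Nat.card V ∧ ∀ U : Set V, G.IsCutSet U → ¬ U.ncard < k}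

/-- For finite nonempty graphs the supremum in the definition is a maximum. -/
theorem isGreatest_vertexConnectivity {V : Type u} [Finite V] [Nonempty V]
    (G : SimpleGraph V) :
    IsGreatest {k : ℕ | k < Nat.card V ∧ ∀ U : Set V, G.IsCutSet U → ¬ U.ncard < k}
      G.vertexConnectivity := by
  have hb : BddAbove {k : ℕ | k < Nat.card V ∧ ∀ U : Set V, G.IsCutSet U → ¬ U.ncard < k} :=
    ⟨Nat.card V, fun k hk => hk.1.le⟩
  exact ⟨Nat.sSup_mem ⟨0, Nat.card_pos, by simp⟩ hb, fun k hk => le_csSup hb hk⟩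

end SimpleGraph

/-! By `vertexConnectivity_le_degree` it suffices to find a vertex of degree at most 5. Suppose all
degrees are at least 6, and let n be the number of vertices. Minimality makes `G - ab` apex for each
edge `ab`, so some `v` outside `{a, b}` makes `G - ab - v` planar; then `|E| ≤ 3(n-1) - 6 + 1 + deg
v`. Repeating this with an edge at `v` gives a second such vertex `w ≠ v`. Adding the two bounds,
`2|E| ≤ 6n - 16 + deg v + deg w`, while the degree sum is at least `6(n-2) + deg v + deg w`: a
contradiction.

The planar edge bound `3n - 6` is obtained without Euler's formula. Winding numbers turn a plane
embedding into a solution of a linear system mod 2 (`HasEvenDrawing`). Solvability passes to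
subgraphs and contractions and fails for `K₅`. An extremal argument in the style of Mader then finds
a `K₅` minor in any graph with more than `3n - 6` edges
(`HasEvenDrawing.card_edgeFinset_add_six_le`).

For sharpness, deleting a vertex of `K₆` leaves `K₅`, whereas a suitable vertex deletion in a proper
minor leaves at most four vertices or a subgraph of `K₅` minus an edge, which has an explicit
straight line drawing. -/

namespace SimpleGraph

/-! ### Winding of plane curves via continuous logarithms. -/

section Winding

/-- A continuous nowhere zero function on a contractible space has a continuous logarithm. -/
theorem exists_continuous_exp_eq {A : Type*} [TopologicalSpace A] [SimplyConnectedSpace A]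
    [LocallyPathConnectedSpace A] (f : A → ℂ) (hf : Continuous f) (h0 : ∀ x, f x ≠ 0) :
    ∃ L : A → ℂ, Continuous L ∧ ∀ x, Complex.exp (L x) = f x := by
  obtain ⟨x₀⟩ : Nonempty A := inferInstance
  rcases Complex.isCoveringMapOn_exp.existsUnique_continuousMap_lifts
    ⟨f, hf⟩ (Complex.exp_log (h0 x₀)) (fun x ↦ h0 x) with ⟨L, ⟨-, hL⟩, -⟩
  exact ⟨L, L.continuous, fun x ↦ congrFun hL x⟩

/-- The variation over `[0, 1]` of a continuous logarithm of `f`. -/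
noncomputable def logVariation (f : ℝ → ℂ) : ℂ :=
  open Classical in
  if h : ∃ L : ℝ → ℂ, Continuous L ∧ ∀ x, Complex.exp (L x) = f x then
    h.choose 1 - h.choose 0 else 0

/-- Two continuous logarithms differ by a continuous function with values in `2πiℤ`, hence by a
constant, so the variation does not depend on the choice. -/
theorem logVariation_eq {f L : ℝ → ℂ} (hL : Continuous L) (hf : ∀ x, Complex.exp (L x) = f x) :
    logVariation f = L 1 - L 0 := by
  have h : ∃ L : ℝ → ℂ, Continuous L ∧ ∀ x, Complex.exp (L x) = f x := ⟨L, hL, hf⟩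
  rw [logVariation, dif_pos h]
  obtain ⟨hM, hMf⟩ := h.choose_spec
  set M := h.choose
  have hdisc : ∀ x, ∃ n : ℤ, M x - L x = n * (2 * Real.pi * Complex.I) := fun x ↦ by
    obtain ⟨n, hn⟩ := Complex.exp_eq_exp_iff_exists_int.1 ((hMf x).trans (hf x).symm)
    exact ⟨n, by rw [hn]; ring⟩
  choose n hn using hdisc
  have hc : Continuous fun x ↦ (n x : ℝ) := by
    have : (fun x ↦ (n x : ℝ)) = fun x ↦ ((M x - L x) / (2 * Real.pi * Complex.I)).re := by
      ext x
      rw [hn, mul_div_cancel_right₀ _ Complex.two_pi_I_ne_zero, Complex.intCast_re]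
    rw [this]
    exact Complex.continuous_re.comp ((hM.sub hL).div_const _)
  have hc' : Continuous n := Int.isClosedEmbedding_coe_real.isEmbedding.continuous_iff.2 hc
  have h01 : n 1 = n 0 := PreconnectedSpace.constant inferInstance hc'
  have h1 := hn 1
  have h0 := hn 0
  rw [h01, ← h0] at h1
  linear_combination h1

theorem exists_logVariation_eq {f : ℝ → ℂ} (hf : Continuous f) (h0 : ∀ x, f x ≠ 0) :
    ∃ n : ℤ, logVariation f =
      Complex.log (f 1) - Complex.log (f 0) + n * (2 * Real.pi * Complex.I) := by
  obtain ⟨L, hL, hLf⟩ := exists_continuous_exp_eq f hf h0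
  rw [logVariation_eq hL hLf]
  refine Complex.exp_eq_exp_iff_exists_int.1 ?_
  rw [Complex.exp_sub, Complex.exp_sub, hLf, hLf, Complex.exp_log (h0 _), Complex.exp_log (h0 _)]

/-- The vector from a point on one curve to a point on a disjoint curve has no winding along the
boundary of the parameter square. -/
theorem logVariation_add_eq_add {γ δ : ℝ → ℂ} (hγ : Continuous γ) (hδ : Continuous δ)
    (h : ∀ t u, γ t ≠ δ u) :
    logVariation (fun t ↦ γ t - δ 0) + logVariation (fun u ↦ δ u - γ 1) =
      logVariation (fun t ↦ γ t - δ 1) + logVariation (fun u ↦ δ u - γ 0) := by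
  obtain ⟨L, hL, hLf⟩ := exists_continuous_exp_eq (A := ℝ × ℝ) (fun x ↦ γ x.1 - δ x.2)
    (by fun_prop) fun x ↦ sub_ne_zero.2 (h _ _)
  have h1 : ∀ u, logVariation (fun t ↦ γ t - δ u) = L (1, u) - L (0, u) := fun u ↦
    logVariation_eq (L := fun t ↦ L (t, u)) (by fun_prop) fun t ↦ hLf (t, u)
  have h2 : ∀ t, logVariation (fun u ↦ δ u - γ t) = L (t, 1) - L (t, 0) := fun t ↦ by
    -- Reversing the difference vector multiplies it by `-1`, so the logarithm is shifted by `πi`.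
    rw [logVariation_eq (L := fun u ↦ L (t, u) + Real.pi * Complex.I) (by fun_prop) fun u ↦ by
      rw [Complex.exp_add, hLf, Complex.exp_pi_mul_I]; ring]
    ring
  rw [h1, h1, h2, h2]
  ring

theorem exists_log_sub_log_neg {z : ℂ} (hz : z ≠ 0) :
    ∃ n : ℤ, Complex.log z - Complex.log (-z) = (2 * n - 1) * (Real.pi * Complex.I) := by
  have : Complex.exp (Complex.log z) = Complex.exp (Complex.log (-z) - Real.pi * Complex.I) := by
    rw [Complex.exp_sub, Complex.exp_pi_mul_I, Complex.exp_log hz,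
      Complex.exp_log (neg_ne_zero.2 hz)]
    ring
  obtain ⟨n, hn⟩ := Complex.exp_eq_exp_iff_exists_int.1 this
  exact ⟨n, by rw [hn]; ring⟩

end Winding

/-! ### From plane embeddings to a linear system mod 2. -/

/-- The graph `G` admits a solution of the system of linear equations over `ZMod 2` that expresses
that the crossings of disjoint edges can all be made even: `s a b` tells on which side of each
other the vertices `a` and `b` are, and `n a p q` tells how `a` lies with respect to the edge from
`p` to `q`. -/
def HasEvenDrawing {V : Type u} (G : SimpleGraph V) : Prop :=
  ∃ (s : V → V → ZMod 2) (n : V → V → V → ZMod 2), (∀ a b, a ≠ b → s a b + s b a = 1) ∧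
    ∀ p q r t, G.Adj p q → G.Adj r t → p ≠ r → p ≠ t → q ≠ r → q ≠ t →
      n r p q + n t p q + n p r t + n q r t = s p r + s q r + s p t + s q t

/-- A graph drawn in the plane by curves, disjoint for disjoint edges, has an even drawing. -/
theorem hasEvenDrawing_of_curves {V : Type u} {G : SimpleGraph V} (pt : V → ℂ)
    (hpt : Function.Injective pt) (γ : V → V → ℝ → ℂ)
    (hγ : ∀ p q, G.Adj p q → Continuous (γ p q) ∧ γ p q 0 = pt p ∧ γ p q 1 = pt q ∧
      ∀ a, a ≠ p → a ≠ q → ∀ x, γ p q x ≠ pt a)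
    (hd : ∀ p q r t, G.Adj p q → G.Adj r t → p ≠ r → p ≠ t → q ≠ r → q ≠ t →
      ∀ x y, γ p q x ≠ γ r t y) : G.HasEvenDrawing := by
  have hs : ∀ a b, ∃ s : ℤ, a ≠ b → Complex.log (pt a - pt b) - Complex.log (pt b - pt a) =
      (2 * s - 1) * (Real.pi * Complex.I) := fun a b ↦ by
    by_cases hab : a = b
    · exact ⟨0, fun h ↦ (h hab).elim⟩
    · obtain ⟨s, hs⟩ := exists_log_sub_log_neg (sub_ne_zero.2 (hpt.ne hab))
      exact ⟨s, fun _ ↦ by rw [← hs, neg_sub]⟩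
  have hn : ∀ a p q, ∃ n : ℤ, G.Adj p q → a ≠ p → a ≠ q →
      logVariation (fun x ↦ γ p q x - pt a) = Complex.log (pt q - pt a) -
        Complex.log (pt p - pt a) + n * (2 * Real.pi * Complex.I) := fun a p q ↦ by
    by_cases h : G.Adj p q ∧ a ≠ p ∧ a ≠ q
    · obtain ⟨hpq, hp, hq⟩ := h
      obtain ⟨hc, h0, h1, ha⟩ := hγ p q hpq
      obtain ⟨n, hn⟩ := exists_logVariation_eq (f := fun x ↦ γ p q x - pt a) (by fun_prop)
        fun x ↦ sub_ne_zero.2 (ha a hp hq x)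
      exact ⟨n, fun _ _ _ ↦ by rw [hn, h0, h1]⟩
    · exact ⟨0, fun h1 h2 h3 ↦ (h ⟨h1, h2, h3⟩).elim⟩
  choose s hs using hs
  choose n hn using hn
  have hpi : (Real.pi * Complex.I : ℂ) ≠ 0 := by simp [Real.pi_ne_zero]
  refine ⟨fun a b ↦ s a b, fun a p q ↦ n a p q, fun a b hab ↦ ?_, ?_⟩
  · have h1 := hs a b hab
    have h2 := hs b a hab.symm
    have h3 : ((s a b + s b a : ℤ) : ℂ) = (1 : ℤ) := by
      refine mul_right_cancel₀ hpi ?_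
      push_cast
      linear_combination (-1 / 2 : ℂ) * h1 - (1 / 2 : ℂ) * h2
    simpa using congrArg (Int.cast : ℤ → ZMod 2) (Int.cast_injective h3)
  · intro p q r t hpq hrt hpr hpt' hqr hqt
    obtain ⟨hc, h0, h1, -⟩ := hγ p q hpq
    obtain ⟨hc', h0', h1', -⟩ := hγ r t hrt
    have key := logVariation_add_eq_add hc hc' (hd p q r t hpq hrt hpr hpt' hqr hqt)
    rw [h0, h1, h0', h1', hn r p q hpq hpr.symm hqr.symm, hn q r t hrt hqr hqt,
      hn t p q hpq hpt'.symm hqt.symm, hn p r t hrt hpr hpt'] at key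
    have h3 : ((s q r - s q t - s p r + s p t + n r p q + n q r t - n t p q - n p r t : ℤ) : ℂ)
        = (0 : ℤ) := by
      refine mul_right_cancel₀ hpi ?_
      push_cast
      linear_combination (1 / 2 : ℂ) * key - (1 / 2 : ℂ) * hs q r hqr + (1 / 2 : ℂ) * hs q t hqt
        + (1 / 2 : ℂ) * hs p r hpr - (1 / 2 : ℂ) * hs p t hpt'
    have h4 := congrArg (Int.cast : ℤ → ZMod 2) (Int.cast_injective h3)
    push_cast at h4
    have two : (2 : ZMod 2) = 0 := rfl
    linear_combination h4 + ((n t p q : ZMod 2) + n p r t - s q r - s p t) * two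

theorem IsPlanar.hasEvenDrawing {V : Type u} {G : SimpleGraph V} (h : G.IsPlanar) :
    G.HasEvenDrawing := by
  obtain ⟨E⟩ := h
  let c : EuclideanSpace ℝ (Fin 2) → ℂ := Complex.orthonormalBasisOneI.repr.symm
  have hc : Continuous c := LinearIsometryEquiv.continuous _
  have hinj : Function.Injective c := LinearIsometryEquiv.injective _
  have hex : ∀ p q, ∃ g : ℝ → EuclideanSpace ℝ (Fin 2), G.Adj p q → Continuous g ∧
      g 0 = E.point p ∧ g 1 = E.point q ∧ ∀ x, g x ∈ E.edge s(p, q) := fun p q ↦ by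
    by_cases hpq : G.Adj p q
    · obtain ⟨γ, -, hγ⟩ := E.isPlaneArc p q hpq
      refine ⟨γ.extend, fun _ ↦ ⟨γ.continuous_extend, γ.extend_zero, γ.extend_one, fun x ↦ ?_⟩⟩
      rw [← hγ]
      exact γ.extend_range ▸ Set.mem_range_self x
    · exact ⟨fun _ ↦ 0, fun h ↦ (hpq h).elim⟩
  choose g hg using hex
  refine hasEvenDrawing_of_curves (fun a ↦ c (E.point a)) (hinj.comp E.point_injective)
    (fun p q x ↦ c (g p q x)) ?_ ?_
  · intro p q hpq
    obtain ⟨h1, h2, h3, h4⟩ := hg p q hpq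
    refine ⟨hc.comp h1, congrArg c h2, congrArg c h3, fun a hap haq x hx ↦ ?_⟩
    have := E.mem_of_point_mem s(p, q) hpq a (hinj hx ▸ h4 x)
    simp [hap, haq] at this
  · intro p q r t hpq hrt hpr hpt hqr hqt x y hxy
    have h := E.edge_inter_edge s(p, q) hpq s(r, t) hrt (by simp [hpr, hpt])
      ⟨(hg p q hpq).2.2.2 x, hinj hxy ▸ (hg r t hrt).2.2.2 y⟩
    obtain ⟨d, ⟨hd1, hd2⟩, -⟩ := h
    simp only [Sym2.mem_iff] at hd1 hd2
    grind

/-! ### Even drawings: heredity, contraction, and the obstruction `K₅`. -/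

section EvenDrawing

variable {V : Type u} {W : Type v}

theorem HasEvenDrawing.comap {G : SimpleGraph V} (h : G.HasEvenDrawing) {H : SimpleGraph W}
    (f : W → V) (hf : Function.Injective f) (hadj : ∀ a b, H.Adj a b → G.Adj (f a) (f b)) :
    H.HasEvenDrawing := by
  obtain ⟨s, n, hs, hn⟩ := h
  exact ⟨fun a b ↦ s (f a) (f b), fun a p q ↦ n (f a) (f p) (f q),
    fun a b hab ↦ hs _ _ (hf.ne hab), fun p q r t hpq hrt h1 h2 h3 h4 ↦
      hn _ _ _ _ (hadj _ _ hpq) (hadj _ _ hrt) (hf.ne h1) (hf.ne h2) (hf.ne h3) (hf.ne h4)⟩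

/-- The five vertices of a complete graph do not have an even drawing. -/
theorem HasEvenDrawing.false_of_five {G : SimpleGraph V} (h : G.HasEvenDrawing) (a b c d e : V)
    (hab : G.Adj a b) (hac : G.Adj a c) (had : G.Adj a d) (hae : G.Adj a e) (hbc : G.Adj b c)
    (hbd : G.Adj b d) (hbe : G.Adj b e) (hcd : G.Adj c d) (hce : G.Adj c e) (hde : G.Adj d e) :
    False := by
  obtain ⟨s, n, hs, hn⟩ := h
  have hn' : ∀ p q r t, G.Adj p q → G.Adj r t → G.Adj p r → G.Adj p t → G.Adj q r → G.Adj q t →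
      n r p q + n t p q + n p r t + n q r t = s p r + s q r + s p t + s q t :=
    fun p q r t h1 h2 h3 h4 h5 h6 ↦ hn p q r t h1 h2 h3.ne h4.ne h5.ne h6.ne
  have key : (1 : ZMod 2) = 0 := by
    have sbc := hs _ _ hbc.ne
    have sbd := hs _ _ hbd.ne
    have sbe := hs _ _ hbe.ne
    have scd := hs _ _ hcd.ne
    have sce := hs _ _ hce.ne
    have sde := hs _ _ hde.ne
    have e1 := hn' a b c d hab hcd hac had hbc hbd
    have e2 := hn' a c b d hac hbd hab had hbc.symm hcd
    have e3 := hn' a d b c had hbc hab hac hbd.symm hcd.symm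
    have e4 := hn' a b c e hab hce hac hae hbc hbe
    have e5 := hn' a c b e hac hbe hab hae hbc.symm hce
    have e6 := hn' a e b c hae hbc hab hac hbe.symm hce.symm
    have e7 := hn' a b d e hab hde had hae hbd hbe
    have e8 := hn' a d b e had hbe hab hae hbd.symm hde
    have e9 := hn' a e b d hae hbd hab had hbe.symm hde.symm
    have e10 := hn' a c d e hac hde had hae hcd hce
    have e11 := hn' a d c e had hce hac hae hcd.symm hde
    have e12 := hn' a e c d hae hcd hac had hce.symm hde.symm
    have e13 := hn' b c d e hbc hde hbd hbe hcd hce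
    have e14 := hn' b d c e hbd hce hbc hbe hcd.symm hde
    have e15 := hn' b e c d hbe hcd hbc hbd hce.symm hde.symm
    -- In the sum of the fifteen equations each `n` term occurs twice and each pair of vertices
    -- occurs in six `s` terms. Exactly fifteen of these have their arguments in reverse
    -- alphabetical order; reordering each adds 1, so an odd constant remains.
    grind
  exact one_ne_zero key

/-- Contract the edge from `a` to `b` into `b`; the vertex `a` is kept as an isolated vertex. -/
def contractInto (G : SimpleGraph V) (a b : V) : SimpleGraph V where
  Adj x y := x ≠ a ∧ y ≠ a ∧ x ≠ y ∧ (G.Adj x y ∨ x = b ∧ G.Adj a y ∨ y = b ∧ G.Adj a x)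
  symm := ⟨by
    rintro x y ⟨h1, h2, h3, h4⟩
    have := G.adj_comm x y
    tauto⟩
  loopless := ⟨fun _ h ↦ h.2.2.1 rfl⟩

theorem contractInto_adj {G : SimpleGraph V} {a b x y : V} : (G.contractInto a b).Adj x y ↔
    x ≠ a ∧ y ≠ a ∧ x ≠ y ∧ (G.Adj x y ∨ x = b ∧ G.Adj a y ∨ y = b ∧ G.Adj a x) :=
  Iff.rfl

/-- An edge `bz` that replaces `az` is treated as the path `b a z`: its equations are the sums of
those for `ab` and `az`, where the terms of the inner vertex `a` cancel mod 2. -/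
theorem HasEvenDrawing.contractInto {G : SimpleGraph V} (h : G.HasEvenDrawing) {a b : V}
    (hab : G.Adj a b) : (G.contractInto a b).HasEvenDrawing := by
  classical
  obtain ⟨s, n, hs, hn⟩ := h
  have add_self : ∀ z : ZMod 2, z + z = 0 := by decide
  -- Four reversals contribute `4 = 0`.
  have flip : ∀ p q r t, p ≠ r → p ≠ t → q ≠ r → q ≠ t →
      s p r + s q r + s p t + s q t = s r p + s t p + s r q + s t q := by
    intro p q r t h1 h2 h3 h4
    have := hs _ _ h1
    have := hs _ _ h2
    have := hs _ _ h3
    have := hs _ _ h4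
    grind
  -- Edges already in `G` keep their values; only new edges receive the value of the path through
  -- `a`.
  let n' : V → V → V → ZMod 2 := fun u p q ↦
    if G.Adj p q then n u p q else if p = b then n u a b + n u a q else n u a b + n u a p
  -- the equation of a derived edge `b z` and an edge `r t`
  have main : ∀ z r t, G.Adj a z → G.Adj r t → a ≠ r → a ≠ t → b ≠ r → b ≠ t → z ≠ r → z ≠ t →
      (n r a b + n r a z) + (n t a b + n t a z) + n b r t + n z r t =
        s b r + s z r + s b t + s z t := by
    intro z r t haz hrt h1 h2 h3 h4 h5 h6
    have e1 := hn a b r t hab hrt h1 h2 h3 h4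
    have e2 := hn a z r t haz hrt h1 h2 h5 h6
    grind
  refine ⟨s, n', hs, ?_⟩
  -- one edge belongs to `G`
  have half : ∀ p q r t, (G.contractInto a b).Adj p q → G.Adj r t → r ≠ a → t ≠ a → p ≠ r →
      p ≠ t → q ≠ r → q ≠ t →
      n' r p q + n' t p q + n p r t + n q r t = s p r + s q r + s p t + s q t := by
    rintro p q r t ⟨hp, hq, hpq, h⟩ hrt hr ht h1 h2 h3 h4
    by_cases hG : G.Adj p q
    · simp only [n', if_pos hG]
      exact hn p q r t hG hrt h1 h2 h3 h4
    · rcases h with h | ⟨rfl, h⟩ | ⟨rfl, h⟩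
      · exact (hG h).elim
      · simp only [n', if_neg hG, if_true]
        exact main q r t h hrt hr.symm ht.symm h1 h2 h3 h4
      · simp only [n', if_neg hG, if_neg hpq]
        have := main p r t h hrt hr.symm ht.symm h3 h4 h1 h2
        grind
  intro p q r t hpq hrt h1 h2 h3 h4
  by_cases hr : G.Adj r t
  · have := half p q r t hpq hr hrt.1 hrt.2.1 h1 h2 h3 h4
    simpa only [n', if_pos hr] using this
  by_cases hp : G.Adj p q
  · have := half r t p q hrt hp hpq.1 hpq.2.1 h1.symm h3.symm h2.symm h4.symm
    rw [flip p q r t h1 h2 h3 h4]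
    have e1 : ∀ u, n' u p q = n u p q := fun u ↦ if_pos hp
    rw [e1, e1]
    linear_combination this
  -- Two new edges both end in `b`, so they are never disjoint.
  · obtain ⟨-, -, -, hpq⟩ := hpq
    obtain ⟨-, -, -, hrt⟩ := hrt
    grind

end EvenDrawing

/-! ### The edge bound `3n - 6`. -/

section EdgeBound

variable {V : Type u}

/-- The six vertices of a complete graph without the disjoint edges `bc` and `de` do not have an
even drawing: contracting `bd` gives a complete graph on five vertices. -/
theorem HasEvenDrawing.false_of_six {G : SimpleGraph V} (h : G.HasEvenDrawing) (a b c d e f : V)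
    (hab : G.Adj a b) (hac : G.Adj a c) (had : G.Adj a d) (hae : G.Adj a e) (haf : G.Adj a f)
    (hbc : b ≠ c) (hde : d ≠ e) (hbd : G.Adj b d) (hbe : G.Adj b e) (hbf : G.Adj b f)
    (hcd : G.Adj c d) (hce : G.Adj c e) (hcf : G.Adj c f) (hdf : G.Adj d f) (hef : G.Adj e f) :
    False := by
  have hadj : ∀ x y, x ≠ d → y ≠ d → G.Adj x y → (G.contractInto d b).Adj x y :=
    fun x y hx hy hxy ↦ ⟨hx, hy, hxy.ne, .inl hxy⟩
  refine (h.contractInto hbd.symm).false_of_five a b c e f ?_ ?_ ?_ ?_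
    ⟨hbd.ne, hcd.ne, hbc, .inr (.inl ⟨rfl, hcd.symm⟩)⟩ ?_ ?_ ?_ ?_ ?_ <;>
  exact hadj _ _ (by first | exact hde.symm | exact SimpleGraph.Adj.ne ‹_›)
    (by first | exact hde.symm | exact hdf.ne.symm | exact SimpleGraph.Adj.ne ‹_›) ‹_›

theorem HasEvenDrawing.induce_compl_singleton {G : SimpleGraph V} (h : G.HasEvenDrawing) (a : V) :
    (G.induce ({a}ᶜ : Set V)).HasEvenDrawing :=
  h.comap Subtype.val Subtype.val_injective fun _ _ h ↦ h

theorem exists_le_card_edgeFinset_eq [Fintype V] (G : SimpleGraph V) [DecidableRel G.Adj] {k : ℕ}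
    (hk : k ≤ G.edgeFinset.card) :
    ∃ (H : SimpleGraph V) (_ : DecidableRel H.Adj), H ≤ G ∧ H.edgeFinset.card = k := by
  classical
  obtain ⟨t, ht, rfl⟩ := Finset.exists_subset_card_eq hk
  obtain ⟨H, hH⟩ : ∃ H : SimpleGraph V, H.edgeSet = t := by
    refine ⟨fromEdgeSet t, ?_⟩
    rw [edgeSet_fromEdgeSet, sdiff_eq_left, Set.disjoint_left]
    exact fun e he ↦ G.not_isDiag_of_mem_edgeSet (mem_edgeFinset.1 (ht he))
  refine ⟨H, Classical.decRel _, ?_, ?_⟩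
  · rw [← edgeSet_subset_edgeSet, hH]
    exact fun e he ↦ mem_edgeFinset.1 (ht he)
  · congr 1
    ext e
    rw [mem_edgeFinset, hH, Finset.mem_coe]

variable [Fintype V] [DecidableEq V]

/-- Contraction loses the edge `ab` and, for each common neighbour of `a` and `b`, one of two
parallel edges. The other neighbours of `a` yield new edges at `b`. -/
theorem card_edgeFinset_contractInto (G : SimpleGraph V) [DecidableRel G.Adj] {a b : V}
    (hab : G.Adj a b) [DecidableRel (G.contractInto a b).Adj] :
    G.edgeFinset.card ≤ ((G.contractInto a b).induce ({a}ᶜ : Set V)).edgeFinset.card + 1 +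
      (G.neighborFinset a ∩ G.neighborFinset b).card := by
  rw [card_edgeFinset_induce_compl_singleton]
  have hdeg : G.edgeFinset.card ≤ (G.deleteIncidenceSet a).edgeFinset.card + G.degree a := by
    rw [card_edgeFinset_deleteIncidenceSet]
    omega
  have hN : G.degree a = ((G.neighborFinset a \ G.neighborFinset b).erase b).card + 1 +
      (G.neighborFinset a ∩ G.neighborFinset b).card := by
    rw [Finset.card_erase_add_one (by simpa using hab), Finset.card_sdiff_add_card_inter,
      card_neighborFinset_eq_degree]
  set D := (G.neighborFinset a \ G.neighborFinset b).erase b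
  have hinj : (D.image fun z ↦ s(b, z)).card = D.card :=
    Finset.card_image_of_injective _ fun x y hxy ↦ Sym2.congr_right.1 hxy
  have hdisj : Disjoint (G.deleteIncidenceSet a).edgeFinset (D.image fun z ↦ s(b, z)) := by
    rw [Finset.disjoint_right]
    intro e he
    obtain ⟨z, hz, rfl⟩ := Finset.mem_image.1 he
    simp only [D, Finset.mem_erase, Finset.mem_sdiff, mem_neighborFinset] at hz
    rw [mem_edgeFinset, mem_edgeSet, deleteIncidenceSet_adj]
    tauto
  have hsub : (G.deleteIncidenceSet a).edgeFinset ∪ (D.image fun z ↦ s(b, z)) ⊆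
      ((G.contractInto a b).deleteIncidenceSet a).edgeFinset := by
    intro e
    induction e with
    | _ x y =>
      simp only [Finset.mem_union, Finset.mem_image, mem_edgeFinset, mem_edgeSet,
        deleteIncidenceSet_adj, contractInto_adj, D, Finset.mem_erase, Finset.mem_sdiff,
        mem_neighborFinset, Sym2.eq_iff]
      rintro (⟨hxy, hx, hy⟩ | ⟨z, ⟨hzb, haz, hz⟩, ⟨rfl, rfl⟩ | ⟨rfl, rfl⟩⟩)
      · exact ⟨⟨hx, hy, hxy.ne, .inl hxy⟩, hx, hy⟩
      · exact ⟨⟨hab.ne', haz.ne', Ne.symm hzb, .inr (.inl ⟨rfl, haz⟩)⟩, hab.ne', haz.ne'⟩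
      · exact ⟨⟨haz.ne', hab.ne', hzb, .inr (.inr ⟨rfl, haz⟩)⟩, haz.ne', hab.ne'⟩
  have := Finset.card_le_card hsub
  rw [Finset.card_union_of_disjoint hdisj, hinj] at this
  omega

/-- In a neighbourhood with at most five vertices each of which has at most one non-neighbour
there is a forbidden subgraph. -/
theorem HasEvenDrawing.false_of_neighborhood {G : SimpleGraph V} [DecidableRel G.Adj]
    (h : G.HasEvenDrawing) (a : V) (h4 : 4 ≤ G.degree a) (h5 : G.degree a ≤ 5)
    (hN : ∀ b, G.Adj a b → 3 ≤ (G.neighborFinset a ∩ G.neighborFinset b).card) : False := by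
  -- The difference contains `b` itself, so at most one further vertex of the neighbourhood is not
  -- adjacent to `b`.
  have hM : ∀ b, G.Adj a b → (G.neighborFinset a \ G.neighborFinset b).card + 3 ≤ G.degree a := by
    intro b hb
    have := hN b hb
    have := Finset.card_sdiff_add_card_inter (G.neighborFinset a) (G.neighborFinset b)
    rw [card_neighborFinset_eq_degree] at this
    omega
  have hadj : ∀ b c d, G.Adj a b → G.Adj a c → G.Adj a d → b ≠ c → b ≠ d → c ≠ d →
      G.Adj b c ∨ G.Adj b d := by
    intro b c d hb hc hd hbc hbd hcd
    by_contra hcon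
    rw [not_or] at hcon
    have hsub : ({b, c, d} : Finset V) ⊆ G.neighborFinset a \ G.neighborFinset b := by
      intro x
      simp only [Finset.mem_insert, Finset.mem_singleton, Finset.mem_sdiff, mem_neighborFinset]
      rintro (rfl | rfl | rfl)
      · exact ⟨hb, G.irrefl⟩
      · exact ⟨hc, hcon.1⟩
      · exact ⟨hd, hcon.2⟩
    have := Finset.card_le_card hsub
    rw [Finset.card_eq_three.2 ⟨b, c, d, hbc, hbd, hcd, rfl⟩] at this
    have := hM b hb
    omega
  by_cases hmiss : ∃ b c, G.Adj a b ∧ G.Adj a c ∧ b ≠ c ∧ ¬ G.Adj b c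
  · obtain ⟨b, c, hb, hc, hbc, hnbc⟩ := hmiss
    have hsub : ({b, c} : Finset V) ⊆ G.neighborFinset a \ G.neighborFinset b := by
      intro x
      simp only [Finset.mem_insert, Finset.mem_singleton, Finset.mem_sdiff, mem_neighborFinset]
      rintro (rfl | rfl)
      · exact ⟨hb, G.irrefl⟩
      · exact ⟨hc, hnbc⟩
    have := Finset.card_le_card hsub
    rw [Finset.card_pair hbc] at this
    have := hM b hb
    -- The difference contains both `b` and `c`, which forces degree exactly 5 and leaves three more
    -- neighbours.
    have h3 : ((G.neighborFinset a).erase b |>.erase c).card = 3 := by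
      rw [Finset.card_erase_of_mem (by simp [hc, hbc.symm]), Finset.card_erase_of_mem (by simp [hb]),
        card_neighborFinset_eq_degree]
      omega
    obtain ⟨d, e, f, hde, hdf, hef, hdef⟩ := Finset.card_eq_three.1 h3
    have hmem : ∀ x ∈ ({d, e, f} : Finset V), x ≠ c ∧ x ≠ b ∧ G.Adj a x := fun x hx ↦ by
      simpa [← hdef] using hx
    obtain ⟨hdc, hdb, hd⟩ := hmem d (by simp)
    obtain ⟨hec, heb, he⟩ := hmem e (by simp)
    obtain ⟨hfc, hfb, hf⟩ := hmem f (by simp)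
    have hB : ∀ x, x ≠ c → x ≠ b → G.Adj a x → G.Adj b x := fun x hxc hxb hx ↦
      (hadj b c x hb hc hx hbc hxb.symm hxc.symm).resolve_left hnbc
    have hC : ∀ x, x ≠ c → x ≠ b → G.Adj a x → G.Adj c x := fun x hxc hxb hx ↦
      (hadj c b x hc hb hx hbc.symm hxc.symm hxb.symm).resolve_left fun h ↦ hnbc h.symm
    have hsix : ∀ d e f, d ≠ e → d ≠ f → e ≠ f → d ≠ c → d ≠ b → G.Adj a d → e ≠ c → e ≠ b →
        G.Adj a e → f ≠ c → f ≠ b → G.Adj a f → G.Adj d e := by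
      intro d e f hde hdf hef hdc hdb hd hec heb he hfc hfb hf
      by_contra hnde
      exact h.false_of_six a b c d e f hb hc hd he hf hbc hde (hB d hdc hdb hd) (hB e hec heb he)
        (hB f hfc hfb hf) (hC d hdc hdb hd) (hC e hec heb he) (hC f hfc hfb hf)
        ((hadj d e f hd he hf hde hdf hef).resolve_left hnde)
        ((hadj e d f he hd hf hde.symm hef hdf).resolve_left fun h ↦ hnde h.symm)
    exact h.false_of_five a b d e f hb hd he hf (hB d hdc hdb hd) (hB e hec heb he)
      (hB f hfc hfb hf) (hsix d e f hde hdf hef hdc hdb hd hec heb he hfc hfb hf)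
      (hsix d f e hdf hde hef.symm hdc hdb hd hfc hfb hf hec heb he)
      (hsix e f d hef hde.symm hdf.symm hec heb he hfc hfb hf hdc hdb hd)
  · push Not at hmiss
    obtain ⟨t, ht, ht4⟩ := Finset.exists_subset_card_eq
      (h4.trans_eq (G.card_neighborFinset_eq_degree a).symm)
    obtain ⟨b, t', hbt', rfl, ht3⟩ := Finset.card_eq_succ.1 ht4
    obtain ⟨c, d, e, hcd, hce, hde, rfl⟩ := Finset.card_eq_three.1 ht3
    have hmem : ∀ x ∈ insert b ({c, d, e} : Finset V), G.Adj a x := fun x hx ↦ by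
      simpa using ht hx
    have hb := hmem b (by simp)
    have hc := hmem c (by simp)
    have hd := hmem d (by simp)
    have he := hmem e (by simp)
    simp only [Finset.mem_insert, Finset.mem_singleton, not_or] at hbt'
    obtain ⟨hbc, hbd, hbe⟩ := hbt'
    exact h.false_of_five a b c d e hb hc hd he (hmiss b c hb hc hbc) (hmiss b d hb hd hbd)
      (hmiss b e hb he hbe) (hmiss c d hc hd hcd) (hmiss c e hc he hce) (hmiss d e hd he hde)

end EdgeBound

/-- The edge bound for planar graphs, from even drawings. -/
theorem HasEvenDrawing.card_edgeFinset_add_six_le (k : ℕ) (hk : 3 ≤ k) :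
    ∀ (V : Type u) [Fintype V] [DecidableEq V] (G : SimpleGraph V) [DecidableRel G.Adj],
      Fintype.card V = k → G.HasEvenDrawing → G.edgeFinset.card + 6 ≤ 3 * k := by
  classical
  induction k, hk using Nat.le_induction with
  | base =>
    intro V _ _ G _ hV _
    have := G.card_edgeFinset_le_card_choose_two
    rw [hV] at this
    simpa [Nat.choose] using this
  | succ k hk ih =>
    intro V _ _ G _ hV hG
    by_contra hcon
    have hle := G.card_edgeFinset_le_card_choose_two
    have hk4 : 4 ≤ k := by
      rcases hk.eq_or_lt with rfl | hk
      · rw [hV] at hle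
        simp [Nat.choose] at hle
        omega
      · exact hk
    -- Here `3k - 2 = 3(k+1) - 5` is one edge too many. Having exactly this number makes the degree
    -- sum `6k - 4 < 6(k+1)`, so a vertex of degree at most 5 exists.
    obtain ⟨H, _, hHG, hH⟩ := G.exists_le_card_edgeFinset_eq (k := 3 * k - 2) (by omega)
    have hHe : H.HasEvenDrawing := hG.comap id Function.injective_id fun _ _ h ↦ hHG h
    have hcard : ∀ a : V, Fintype.card ({a}ᶜ : Set V) = k := fun a ↦ by
      rw [Fintype.card_compl_set, hV, Fintype.card_unique, Nat.add_sub_cancel]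
    obtain ⟨a, ha⟩ : ∃ a, H.degree a ≤ 5 := by
      by_contra! hdeg
      have h1 := H.sum_degrees_eq_twice_card_edges
      have h2 := Finset.card_nsmul_le_sum Finset.univ (fun v ↦ H.degree v) 6 fun v _ ↦ hdeg v
      rw [smul_eq_mul, Finset.card_univ, hV] at h2
      omega
    refine hHe.false_of_neighborhood a ?_ ha fun b hb ↦ ?_
    -- Deleting `a` must remove at least `(3k - 2) - (3k - 6) = 4` edges.
    · have := ih _ (H.induce ({a}ᶜ : Set V)) (hcard a) (hHe.induce_compl_singleton a)
      rw [card_edgeFinset_induce_compl_singleton, card_edgeFinset_deleteIncidenceSet] at this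
      omega
    -- Contracting `ab` must also lose at least 4 edges: `ab` and three merged ones.
    · have h1 := ih _ ((H.contractInto a b).induce ({a}ᶜ : Set V)) (hcard a)
        ((hHe.contractInto hb).induce_compl_singleton a)
      have h2 := H.card_edgeFinset_contractInto hb
      omega

/-! ### Straight line drawings and small planar graphs. -/

section StraightLine

/-- Twice the signed area of the triangle `a b c`. -/
def signedArea {R : Type*} [Ring R] (a b c : Fin 2 → R) : R :=
  (b 0 - a 0) * (c 1 - a 1) - (b 1 - a 1) * (c 0 - a 0)

theorem isPlaneArc_segment {x y : EuclideanSpace ℝ (Fin 2)} (h : x ≠ y) :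
    IsPlaneArc (segment ℝ x y) x y := by
  refine ⟨⟨⟨fun t ↦ AffineMap.lineMap x y (t : ℝ), by fun_prop⟩, by simp, by simp⟩, ?_, ?_⟩
  · intro s t hst
    exact Subtype.ext (AffineMap.lineMap_injective ℝ h hst)
  · rw [segment_eq_image_lineMap]
    ext z
    simp

/-- The signed area is affine in its third argument; this reduces incidence of segments to signs. -/
theorem exists_signedArea_eq_of_mem_segment {c d z : EuclideanSpace ℝ (Fin 2)}
    (hz : z ∈ segment ℝ c d) : ∃ t : ℝ, 0 ≤ t ∧ t ≤ 1 ∧ z = AffineMap.lineMap c d t ∧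
      ∀ a b : EuclideanSpace ℝ (Fin 2), signedArea a b z =
        (1 - t) * signedArea a b c + t * signedArea a b d := by
  rw [segment_eq_image_lineMap] at hz
  obtain ⟨t, ⟨h0, h1⟩, rfl⟩ := hz
  refine ⟨t, h0, h1, rfl, fun a b ↦ ?_⟩
  simp only [signedArea, AffineMap.lineMap_apply, vsub_eq_sub, vadd_eq_add, PiLp.add_apply,
    PiLp.smul_apply, PiLp.sub_apply, smul_eq_mul]
  ring

theorem signedArea_eq_zero_of_mem_segment {a b z : EuclideanSpace ℝ (Fin 2)}
    (hz : z ∈ segment ℝ a b) : signedArea a b z = 0 := by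
  obtain ⟨t, -, -, -, h⟩ := exists_signedArea_eq_of_mem_segment hz
  rw [h, signedArea, signedArea]
  ring

theorem eq_of_mem_segment_of_mem_segment {a b d z : EuclideanSpace ℝ (Fin 2)}
    (h : signedArea a b d ≠ 0) (hb : z ∈ segment ℝ a b) (hd : z ∈ segment ℝ a d) : z = a := by
  obtain ⟨t, -, -, rfl, ht⟩ := exists_signedArea_eq_of_mem_segment hd
  have h1 := ht a b
  rw [signedArea_eq_zero_of_mem_segment hb, signedArea_eq_zero_of_mem_segment
    (left_mem_segment ℝ a b), mul_zero, zero_add] at h1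
  rw [(mul_eq_zero.1 h1.symm).resolve_right h, AffineMap.lineMap_apply_zero]

theorem disjoint_segment_of_signedArea {a b c d : EuclideanSpace ℝ (Fin 2)}
    (h : 0 < signedArea a b c * signedArea a b d) :
    Disjoint (segment ℝ a b) (segment ℝ c d) := by
  rw [Set.disjoint_left]
  intro z hz hz'
  obtain ⟨t, h0, h1, -, ht⟩ := exists_signedArea_eq_of_mem_segment hz'
  have h2 := ht a b
  rw [signedArea_eq_zero_of_mem_segment hz] at h2
  rcases pos_and_pos_or_neg_and_neg_of_mul_pos h with ⟨hc, hd⟩ | ⟨hc, hd⟩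
  · nlinarith [mul_nonneg h0 hd.le, mul_nonneg (sub_nonneg.2 h1) hc.le]
  · nlinarith [mul_nonneg h0 (neg_nonneg.2 hd.le), mul_nonneg (sub_nonneg.2 h1) (neg_nonneg.2 hc.le)]

/-- A straight line drawing in which the ends of an edge and a third vertex are never collinear is
an embedding, if for any two disjoint edges the line through one of them has the other one on one
side. -/
theorem isPlanar_of_signedArea {V : Type u} (G : SimpleGraph V)
    (pt : V → EuclideanSpace ℝ (Fin 2)) (hpt : Function.Injective pt)
    (h3 : ∀ a b c, G.Adj a b → c ≠ a → c ≠ b → signedArea (pt a) (pt b) (pt c) ≠ 0)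
    (h4 : ∀ a b c d, G.Adj a b → G.Adj c d → a ≠ c → a ≠ d → b ≠ c → b ≠ d →
      0 < signedArea (pt a) (pt b) (pt c) * signedArea (pt a) (pt b) (pt d) ∨
      0 < signedArea (pt c) (pt d) (pt a) * signedArea (pt c) (pt d) (pt b)) :
    G.IsPlanar := by
  have hshare : ∀ a b d z, G.Adj a b → G.Adj a d → b ≠ d → z ∈ segment ℝ (pt a) (pt b) →
      z ∈ segment ℝ (pt a) (pt d) → z = pt a := fun a b d z hb hd hbd ↦
    eq_of_mem_segment_of_mem_segment (h3 a b d hb hd.ne' hbd.symm)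
  refine ⟨⟨pt, Sym2.lift ⟨fun a b ↦ segment ℝ (pt a) (pt b), fun a b ↦ segment_symm ℝ _ _⟩, hpt,
    fun a b hab ↦ isPlaneArc_segment (hpt.ne hab.ne), ?_, ?_⟩⟩
  · intro e he c hc
    induction e with
    | _ a b =>
      by_contra hcon
      rw [Sym2.mem_iff, not_or] at hcon
      exact h3 a b c he hcon.1 hcon.2 (signedArea_eq_zero_of_mem_segment hc)
  · intro e he f hf hef z hz
    induction e with
    | _ a b =>
    induction f with
    | _ c d =>
      rw [mem_edgeSet] at he hf
      obtain ⟨hz1, hz2⟩ : z ∈ segment ℝ (pt a) (pt b) ∧ z ∈ segment ℝ (pt c) (pt d) := hz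
      by_cases hac : a = c
      · subst hac
        exact ⟨a, by simp, (hshare a b d z he hf (by rintro rfl; exact hef rfl) hz1 hz2).symm⟩
      by_cases had : a = d
      · subst had
        rw [segment_symm] at hz2
        exact ⟨a, by simp,
          (hshare a b c z he hf.symm (by rintro rfl; exact hef Sym2.eq_swap) hz1 hz2).symm⟩
      by_cases hbc : b = c
      · subst hbc
        rw [segment_symm] at hz1
        exact ⟨b, by simp,
          (hshare b a d z he.symm hf (by rintro rfl; exact hef Sym2.eq_swap) hz1 hz2).symm⟩
      by_cases hbd : b = d
      · subst hbd
        rw [segment_symm] at hz1 hz2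
        exact ⟨b, by simp,
          (hshare b a c z he.symm hf.symm (by rintro rfl; exact hef rfl) hz1 hz2).symm⟩
      rcases h4 a b c d he hf hac had hbc hbd with h | h
      · exact (Set.disjoint_left.1 (disjoint_segment_of_signedArea h) hz1 hz2).elim
      · exact (Set.disjoint_left.1 (disjoint_segment_of_signedArea h) hz2 hz1).elim

/-- Vertices of a straight line drawing of a complete graph on five vertices without the edge
between the last two. -/
def fivePoint : Fin 5 → Fin 2 → ℤ :=
  ![![-3, 0], ![3, 0], ![0, 3], ![1, 9], ![0, 1]]

theorem isPlanar_of_map_fin_five {W : Type u} (H : SimpleGraph W) (f : W → Fin 5)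
    (hf : Function.Injective f) (hadj : ∀ a b, H.Adj a b → ¬ (f a = 3 ∧ f b = 4)) :
    H.IsPlanar := by
  -- Integer coordinates let the finitely many sign conditions be decided by computation.
  let pt : W → EuclideanSpace ℝ (Fin 2) := fun a ↦ WithLp.toLp 2 fun i ↦ (fivePoint (f a) i : ℝ)
  have harea : ∀ a b c, signedArea (pt a) (pt b) (pt c) =
      (signedArea (fivePoint (f a)) (fivePoint (f b)) (fivePoint (f c)) : ℤ) := fun a b c ↦ by
    simp [signedArea, pt]
  have h2 : Function.Injective fivePoint := by decide
  have h3 : ∀ a b c : Fin 5, a ≠ b → c ≠ a → c ≠ b →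
      signedArea (fivePoint a) (fivePoint b) (fivePoint c) ≠ 0 := by decide
  have h4 : ∀ a b c d : Fin 5, ¬ (a = 3 ∧ b = 4) → ¬ (b = 3 ∧ a = 4) → ¬ (c = 3 ∧ d = 4) →
      ¬ (d = 3 ∧ c = 4) → a ≠ b → c ≠ d → a ≠ c → a ≠ d → b ≠ c → b ≠ d →
      0 < signedArea (fivePoint a) (fivePoint b) (fivePoint c) *
        signedArea (fivePoint a) (fivePoint b) (fivePoint d) ∨
      0 < signedArea (fivePoint c) (fivePoint d) (fivePoint a) *
        signedArea (fivePoint c) (fivePoint d) (fivePoint b) := by decide +kernel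
  refine H.isPlanar_of_signedArea pt ?_ ?_ ?_
  · intro a b hab
    refine hf (h2 (funext fun i ↦ ?_))
    have := congrArg (fun p : EuclideanSpace ℝ (Fin 2) ↦ p i) hab
    simpa [pt] using this
  · intro a b c hab hca hcb
    rw [harea]
    exact_mod_cast h3 _ _ _ (hf.ne hab.ne) (hf.ne hca) (hf.ne hcb)
  · intro a b c d hab hcd h5 h6 h7 h8
    simp only [harea]
    exact_mod_cast h4 _ _ _ _ (hadj a b hab) (hadj b a hab.symm) (hadj c d hcd)
      (hadj d c hcd.symm) (hf.ne hab.ne) (hf.ne hcd.ne) (hf.ne h5) (hf.ne h6) (hf.ne h7) (hf.ne h8)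

theorem isPlanar_of_card_le_four {W : Type u} [Finite W] (H : SimpleGraph W)
    (h : Nat.card W ≤ 4) : H.IsPlanar := by
  have := Fintype.ofFinite W
  obtain ⟨g⟩ : Nonempty (W ↪ Fin 4) :=
    Function.Embedding.nonempty_of_card_le (by simpa [Nat.card_eq_fintype_card] using h)
  exact H.isPlanar_of_map_fin_five (fun a ↦ (g a).castSucc)
    ((Fin.castSucc_injective 4).comp g.injective) fun a b _ h ↦ (g b).castSucc_lt_last.ne h.2

theorem isPlanar_of_card_le_five {W : Type u} [Finite W] (H : SimpleGraph W)
    (h : Nat.card W ≤ 5) {u v : W} (huv : u ≠ v) (hH : ¬ H.Adj u v) : H.IsPlanar := by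
  have := Fintype.ofFinite W
  obtain ⟨g⟩ : Nonempty (W ↪ Fin 5) :=
    Function.Embedding.nonempty_of_card_le (by simpa [Nat.card_eq_fintype_card] using h)
  have hperm : ∀ x y : Fin 5, x ≠ y → ∃ z w : Fin 5,
      Equiv.swap z w (Equiv.swap x 3 x) = 3 ∧ Equiv.swap z w (Equiv.swap x 3 y) = 4 := by
    intro x y hxy
    -- The first swap sends `x` to 3; the second sends the image of `y` to 4 and fixes 3, as that
    -- image is not 3.
    refine ⟨Equiv.swap x 3 y, 4, ?_⟩
    revert x y
    decide
  obtain ⟨z, w, h3, h4⟩ := hperm (g u) (g v) (g.injective.ne huv)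
  have hinj : Function.Injective fun a ↦ Equiv.swap z w (Equiv.swap (g u) 3 (g a)) :=
    (Equiv.injective _).comp ((Equiv.injective _).comp g.injective)
  refine H.isPlanar_of_map_fin_five _ hinj fun a b hab hcon ↦ hH ?_
  rwa [← hinj (hcon.1.trans h3.symm), ← hinj (hcon.2.trans h4.symm)]

end StraightLine

/-! ### The complete graph `K₆` is MMNA of connectivity 5. -/

section CompleteGraph

theorem not_isPlanar_completeGraph_deleteVertex (x : Fin 6) :
    ¬ ((completeGraph (Fin 6)).deleteVertex x).IsPlanar := by
  intro h
  have h5 : (completeGraph (Fin 5)).HasEvenDrawing :=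
    h.hasEvenDrawing.comap (fun i ↦ ⟨x.succAbove i, x.succAbove_ne i⟩)
      (fun i j hij ↦ x.succAbove_right_injective (congrArg Subtype.val hij))
      fun i j hij ↦ x.succAbove_right_injective.ne hij
  apply h5.false_of_five 0 1 2 3 4 <;> simp

theorem isNotApex_completeGraph_six : (completeGraph (Fin 6)).IsNotApex :=
  ⟨inferInstance, not_isPlanar_completeGraph_deleteVertex⟩

theorem IsContraction.surjective_of {W : Type v} {V : Type u} {H : SimpleGraph W}
    {K : SimpleGraph V} (h : H.IsContraction K) : ∃ φ : V → W, Function.Surjective φ := by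
  obtain ⟨φ, hφ, -⟩ := h
  refine ⟨φ, fun a ↦ ?_⟩
  obtain ⟨⟨x, hx⟩⟩ := (hφ a).nonempty
  exact ⟨x, hx⟩

theorem isMMNA_completeGraph_six : (completeGraph (Fin 6)).IsMMNA := by
  refine ⟨isNotApex_completeGraph_six, ?_⟩
  rintro W H ⟨⟨K, hK⟩, hiso⟩ ⟨⟨w⟩, hH⟩
  obtain ⟨φ, hφ⟩ := hK.surjective_of
  have hfin : Finite W := Finite.of_surjective φ hφ
  have hle : Nat.card W ≤ 6 := (Nat.card_le_card_of_surjective φ hφ).trans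
    ((Nat.card_le_card_of_injective _ Subtype.val_injective).trans (by simp))
  have hcard : ∀ x : W, Nat.card ({x}ᶜ : Set W) = Nat.card W - 1 := fun x ↦ by
    rw [Nat.card_coe_set_eq, Set.ncard_compl, Set.ncard_singleton]
  rcases hle.lt_or_eq with hlt | heq
  · exact hH w (isPlanar_of_card_le_four _ (by rw [hcard]; omega))
  · obtain ⟨u, v, huv, hnadj⟩ : ∃ u v : W, u ≠ v ∧ ¬ H.Adj u v := by
      by_contra! hall
      exact hiso.false ⟨Finite.equivFinOfCardEq heq, fun {a b} ↦
        ⟨fun h ↦ hall a b fun hab ↦ h (congrArg _ hab), fun h ↦ (Equiv.injective _).ne h.ne⟩⟩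
    -- A minor on six vertices lacks some edge `uv`; deleting a vertex other than `u` and `v`
    -- preserves the missing edge.
    obtain ⟨x, hx⟩ : ∃ x, x ∉ ({u, v} : Set W) := by
      by_contra! hall
      have h1 := Set.ncard_le_ncard (fun x _ ↦ hall x : (Set.univ : Set W) ⊆ {u, v})
      have h2 := Set.ncard_pair huv
      rw [Set.ncard_univ] at h1
      omega
    simp only [Set.mem_insert_iff, Set.mem_singleton_iff, not_or] at hx
    refine hH x (isPlanar_of_card_le_five _ (by rw [hcard]; omega)
      (u := ⟨u, Ne.symm hx.1⟩) (v := ⟨v, Ne.symm hx.2⟩) (fun h ↦ huv (congrArg Subtype.val h)) hnadj)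

theorem vertexConnectivity_completeGraph (n : ℕ) :
    (completeGraph (Fin (n + 1))).vertexConnectivity = n := by
  refine IsGreatest.unique (isGreatest_vertexConnectivity _) ⟨⟨by simp, fun U hU ↦ ?_⟩, ?_⟩
  · refine (hU fun a b ↦ ?_).elim
    by_cases hab : a = b
    · exact hab ▸ Reachable.refl _
    · exact Adj.reachable (fun h ↦ hab (Subtype.ext h))
  · rintro k ⟨hk, -⟩
    simpa using Nat.lt_succ_iff.1 (by simpa using hk)

end CompleteGraph

/-! ### A vertex of degree at most 5 in an MMNA graph. -/

section Connectivity

variable {V : Type u}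

theorem isProperMinor_deleteEdges [Finite V] (G : SimpleGraph V) {a b : V} (hab : G.Adj a b) :
    (G.deleteEdges {s(a, b)}).IsProperMinor G := by
  classical
  have := Fintype.ofFinite V
  refine ⟨⟨SimpleGraph.toSubgraph _ (G.deleteEdges_le {s(a, b)}), Subtype.val, fun c ↦ ?_, ?_⟩, ⟨fun e ↦ ?_⟩⟩
  · have hsub : Subsingleton ((Subtype.val : {x : V // x ∈ (Set.univ : Set V)} → V) ⁻¹' {c}) :=
      ⟨fun x y ↦ Subtype.ext (Subtype.ext (x.2.trans y.2.symm))⟩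
    have hne : Nonempty ((Subtype.val : {x : V // x ∈ (Set.univ : Set V)} → V) ⁻¹' {c}) :=
      ⟨⟨⟨c, trivial⟩, rfl⟩⟩
    exact (connected_iff _).2 ⟨fun x y ↦ hsub.elim x y ▸ Reachable.refl _, hne⟩
  · intro x y
    constructor
    · exact fun h ↦ ⟨h.ne, ⟨x, trivial⟩, ⟨y, trivial⟩, h, rfl, rfl⟩
    · rintro ⟨-, x', y', h, rfl, rfl⟩
      exact h
  · have h1 := e.card_edgeFinset_eq
    have h2 : (G.deleteEdges {s(a, b)}).edgeFinset ⊂ G.edgeFinset := by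
      rw [edgeFinset_ssubset_edgeFinset]
      refine lt_of_le_of_ne (G.deleteEdges_le _) fun h ↦ ?_
      have := h ▸ hab
      simp [deleteEdges_adj] at this
    exact (Finset.card_lt_card h2).ne h1

theorem deleteVertex_deleteEdges (G : SimpleGraph V) (a b : V) :
    (G.deleteEdges {s(a, b)}).deleteVertex a = G.deleteVertex a := by
  ext ⟨x, hx⟩ ⟨y, hy⟩
  simp only [Set.mem_compl_iff, Set.mem_singleton_iff] at hx hy
  simp [deleteEdges_adj, hx, hy]

/-- The vertex avoids `a` and `b` because deleting an end of `ab` from `G - ab` gives the same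
nonplanar graph as deleting it from `G`. -/
theorem IsMMNA.exists_isPlanar_deleteVertex [Finite V] {G : SimpleGraph V} (h : G.IsMMNA)
    {a b : V} (hab : G.Adj a b) :
    ∃ x, x ≠ a ∧ x ≠ b ∧ ((G.deleteEdges {s(a, b)}).deleteVertex x).IsPlanar := by
  obtain ⟨x, hx⟩ : ∃ x, ((G.deleteEdges {s(a, b)}).deleteVertex x).IsPlanar := by
    by_contra! hcon
    exact h.2 V _ (G.isProperMinor_deleteEdges hab) ⟨h.1.1, hcon⟩
  refine ⟨x, ?_, ?_, hx⟩
  · rintro rfl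
    exact h.1.2 x (by rwa [deleteVertex_deleteEdges] at hx)
  · rintro rfl
    exact h.1.2 x (by rwa [Sym2.eq_swap, deleteVertex_deleteEdges] at hx)

theorem card_edgeFinset_le_of_isPlanar_deleteVertex [Fintype V] [DecidableEq V]
    (G : SimpleGraph V) [DecidableRel G.Adj] (hV : 4 ≤ Fintype.card V) {a b x : V}
    (hx : ((G.deleteEdges {s(a, b)}).deleteVertex x).IsPlanar) :
    G.edgeFinset.card + 8 ≤ 3 * Fintype.card V + G.degree x := by
  classical
  have hc : Fintype.card ({x}ᶜ : Set V) = Fintype.card V - 1 := by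
    rw [Fintype.card_compl_set, Set.card_singleton]
  have h1 := HasEvenDrawing.card_edgeFinset_add_six_le (Fintype.card V - 1) (by omega) _
    ((G.deleteEdges {s(a, b)}).deleteVertex x) hc hx.hasEvenDrawing
  rw [card_edgeFinset_induce_compl_singleton, card_edgeFinset_deleteIncidenceSet] at h1
  have h2 : (G.deleteEdges {s(a, b)}).degree x ≤ G.degree x :=
    degree_le_of_le (G.deleteEdges_le _)
  have h3 : G.edgeFinset.card ≤ (G.deleteEdges {s(a, b)}).edgeFinset.card + 1 := by
    have hsub : G.edgeFinset ⊆ insert s(a, b) (G.deleteEdges {s(a, b)}).edgeFinset := by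
      intro e he
      rw [mem_edgeFinset] at he
      rw [Finset.mem_insert, mem_edgeFinset, edgeSet_deleteEdges]
      by_cases h : e = s(a, b)
      · exact .inl h
      · exact .inr ⟨he, h⟩
    exact (Finset.card_le_card hsub).trans (Finset.card_insert_le _ _)
  omega

theorem IsMMNA.exists_degree_le_five [Fintype V] {G : SimpleGraph V} [DecidableRel G.Adj]
    (h : G.IsMMNA) : ∃ v, G.degree v ≤ 5 := by
  classical
  by_contra! hdeg
  have hnbr : ∀ v, ∃ w, G.Adj v w := fun v ↦
    (G.degree_pos_iff_exists_adj v).1 (by have := hdeg v; omega)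
  obtain ⟨a⟩ := h.1.1
  obtain ⟨b, hab⟩ := hnbr a
  obtain ⟨v, -, -, hv⟩ := h.exists_isPlanar_deleteVertex hab
  -- Taking the second edge at `v` guarantees `w ≠ v`.
  obtain ⟨u, hvu⟩ := hnbr v
  obtain ⟨w, hwv, -, hw⟩ := h.exists_isPlanar_deleteVertex hvu
  have hV : 4 ≤ Fintype.card V := by
    have := hdeg a
    have := G.degree_lt_card_verts a
    omega
  have hv' := G.card_edgeFinset_le_of_isPlanar_deleteVertex hV hv
  have hw' := G.card_edgeFinset_le_of_isPlanar_deleteVertex hV hw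
  have hsum := G.sum_degrees_eq_twice_card_edges
  rw [← Finset.add_sum_erase _ _ (Finset.mem_univ v),
    ← Finset.add_sum_erase _ _ (Finset.mem_erase.2 ⟨hwv, Finset.mem_univ w⟩)] at hsum
  have hrest := Finset.card_nsmul_le_sum ((Finset.univ.erase v).erase w) (fun x ↦ G.degree x) 6
    fun x _ ↦ hdeg x
  rw [Finset.card_erase_of_mem (Finset.mem_erase.2 ⟨hwv, Finset.mem_univ w⟩),
    Finset.card_erase_of_mem (Finset.mem_univ v), Finset.card_univ, smul_eq_mul] at hrest
  omega

theorem vertexConnectivity_le_degree [Fintype V] (G : SimpleGraph V) [DecidableRel G.Adj] (v : V) :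
    G.vertexConnectivity ≤ G.degree v := by
  classical
  have : Nonempty V := ⟨v⟩
  obtain ⟨hlt, hcut⟩ := (isGreatest_vertexConnectivity G).1
  by_contra! hdeg
  rw [Nat.card_eq_fintype_card] at hlt
  obtain ⟨w, hw⟩ : ∃ w, w ∉ insert v (G.neighborFinset v) := by
    by_contra! hall
    have h1 := Finset.card_le_card (fun x _ ↦ hall x : Finset.univ ⊆ insert v (G.neighborFinset v))
    have h2 := Finset.card_insert_le v (G.neighborFinset v)
    rw [card_neighborFinset_eq_degree] at h2
    rw [Finset.card_univ] at h1
    omega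
  rw [Finset.mem_insert, mem_neighborFinset, not_or] at hw
  -- The neighbourhood of `v` separates `v` from `w`.
  refine hcut (G.neighborSet v) (fun hconn ↦ ?_) ?_
  · obtain ⟨p⟩ := hconn ⟨v, G.irrefl⟩ ⟨w, hw.2⟩
    cases p with
    | nil => exact hw.1 rfl
    | @cons _ y _ hadj _ => exact y.2 hadj
  · rwa [← coe_neighborFinset, Set.ncard_coe_finset, card_neighborFinset_eq_degree]

theorem IsMMNA.vertexConnectivity_le_five [Finite V] {G : SimpleGraph V} (h : G.IsMMNA) :
    G.vertexConnectivity ≤ 5 := by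
  classical
  have := Fintype.ofFinite V
  obtain ⟨v, hv⟩ := h.exists_degree_le_five
  exact (G.vertexConnectivity_le_degree v).trans hv

end Connectivity

end SimpleGraph

theorem mainTheorem7 :
    (∀ (V : Type u) [Finite V] (G : SimpleGraph V), G.IsMMNA → G.vertexConnectivity ≤ 5) ∧
    ((SimpleGraph.completeGraph (Fin 6)).IsMMNA ∧ (SimpleGraph.completeGraph (Fin 6)).vertexConnectivity = 5) :=
  ⟨fun _ _ _ h ↦ h.vertexConnectivity_le_five, SimpleGraph.isMMNA_completeGraph_six,
    SimpleGraph.vertexConnectivity_completeGraph 5⟩
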